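/- Let $\ell^2$ be the real Hilbert space of square-summable sequences $x=(x_n)_{n\ge 1}$, identified with its dual. Let $A:\ell^2\rightrightarrows\ell^2$ be given by $Ax=\big(\sum_{i<n}x_i+\tfrac12x_n\big)_{n\ge1}$ with domain $$\operatorname{dom}A=\Big\{x\in\ell^2:\ \sum_{i\ge1}x_i=0,\ \Big(\sum_{i\le n}x_i\Big)_{n\ge1}\in\ell^2\Big\}$$ (the series being understood as the limit of its partial sums), and let $A^*$ be its adjoint, $\operatorname{gra}A^*=\{(x,x^*):\langle a,x^*\rangle=\langle x,Aa\rangle\ \ \forall a\in\operatorname{dom}A\}$. Let $e_1=(1,0,0,\dots)$ and $C=[0,e_1]=\{te_1:0\le t\le1\}$, with indicator function $\iota_C$, support function $\sigma_C(x^*)=\sup_{c\in C}\langle c,x^*\rangle$ and normal cone operator $N_C$. Let $j:[0,\infty)\to[0,\infty)$ be increasing with $j(\gamma)\ge\gamma/2$ for all $\gamma\ge 0$. Notation, for a real reflexive Banach space $X$. For $B:X\rightrightarrows X^*$, the Fitzpatrick function is $F_B(x,x^*)=\sup_{(b,b^*)\in\operatorname{gra}B}\big(\langle x,b^*\rangle+\langle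 b,x^*\rangle-\langle b,b^*\rangle\big)$. For $F,F_1,F_2:X\times X^*\to(-\infty,+\infty]$, put $\operatorname{dom}F=F^{-1}(\mathbb R)$, $P_X(x,x^*)=x$, $F^*(x^*,x)=\sup_{(y,y^*)}\big(\langle y,x^*\rangle+\langle x,y^*\rangle-F(y,y^*)\big)$, $\operatorname{pos}F=\{(x,x^*):F(x,x^*)=\langle x,x^*\rangle\}$ and $(F_1\Box_2F_2)(x,x^*)=\inf_{v^*\in X^*}\big(F_1(x,x^*-v^*)+F_2(x,v^*)\big)$. A BC-function is a proper convex $F$ with $F^*(x^*,x)\ge F(x,x^*)\ge\langle x,x^*\rangle$ for all $(x,x^*)$. Then $A^*$ is defined and single-valued at every point of $C$, and the following hold. 1. $F_{A^*}$ and $F_{N_C}$ are BC-functions, and $F_{N_C}(x,x^*)=\iota_C(x)+\sigma_C(x^*)$ for all $(x,x^*)$. 2. For all $(x,x^*)$, $(F_{A^*}\Box_2F_{N_C})(x,x^*)=\langle x,A^*x\rangle+\sigma_C(x^*-A^*x)$ if $x\in C$, and $=+\infty$ otherwise. 3. For every $x^*$, $$F_{A^*}^*(x^*,0)+F_{N_C}^*(A^*e_1-x^*,0)\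 \ge\ \tfrac12\ >\ \tfrac18\ \ge\ (F_{A^*}\Box_2F_{N_C})^*(A^*e_1,0).$$ 4. If $(x,x^*)\in\operatorname{pos}F_{N_C}$, $(y,y^*)\in\operatorname{pos}F_{A^*}$, $x\ne y$ and $\langle x-y,y^*\rangle=\|x-y\|\,\|y^*\|$, then $\|y^*\|\le\tfrac12\|y\|\le j\big(\|x\|+\|x^*+y^*\|+\|y\|+\|x-y\|\,\|y^*\|\big)$. 5. $A^*+N_C$ is maximally monotone. Consequently the following question has a negative answer, with $X=\ell^2$, $F_1=F_{N_C}$, $F_2=F_{A^*}$ as a counterexample (all its hypotheses hold, with $j$ as above, and its conclusion fails): let $X$ be a real reflexive Banach space, let $F_1,F_2:X\times X^*\to(-\infty,+\infty]$ be lower semicontinuous BC-functions with $P_X\operatorname{dom}F_1\cap P_X\operatorname{dom}F_2\neq\varnothing$, and let $j:[0,\infty)\to[0,\infty)$ be an increasing function such that $(x,x^*)\in\operatorname{pos}F_1$, $(y,y^*)\in\operatorname{pos}F_2$, $x\ne y$ and $\langle x-y,y^*\rangle=\|x-y\|\,\|y^*\|$ imply $\|y^*\|\le j\big(\|x\|+\|x^*+y^*\|+\|y\|+\|x-y\|\,\|y^*\|\big)$;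 is it true that for all $(z,z^*)\in X\times X^*$ there exists $v^*\in X^*$ with $F_1^*(v^*,z)+F_2^*(z^*-v^*,z)\le(F_1\Box_2F_2)^*(z^*,z)$? -/

import Mathlib

open Set Filter Topology
open scoped NNReal

noncomputable section

namespace FCP

/-! ### Operators `X ⇉ X*`, given by their graphs

`X` is a real normed space, `X*` is `StrongDual ℝ X`, and `⟨x, x*⟩` is `x* x`. -/

section General

variable {X : Type*} [NormedAddCommGroup X] [NormedSpace ℝ X]

/-- The canonical map `X → X**` is onto. -/
def IsReflexive (X : Type*) [NormedAddCommGroup X] [NormedSpace ℝ X] : Prop :=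
  Function.Surjective (NormedSpace.inclusionInDoubleDual ℝ X)

/-- Monotone graphs. -/
def IsMonotone (A : Set (X × StrongDual ℝ X)) : Prop :=
  ∀ p ∈ A, ∀ q ∈ A, 0 ≤ (p.2 - q.2) (p.1 - q.1)

/-- Maximally monotone: monotone without a proper monotone extension. -/
def IsMaximallyMonotone (A : Set (X × StrongDual ℝ X)) : Prop :=
  IsMonotone A ∧ ∀ B : Set (X × StrongDual ℝ X), IsMonotone B → A ⊆ B → B = A

/-- The graph of the adjoint `A*`: the pairs `(x, x*)` such that `(x*, -x)` annihilates the
graph of `A`. -/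
def adjointGraph (A : Set (X × StrongDual ℝ X)) : Set (X × StrongDual ℝ X) :=
  {p | ∀ q ∈ A, p.2 q.1 + q.2 (-p.1) = 0}

/-- The graph of the normal cone operator `N_C`. -/
def normalConeGraph (C : Set X) : Set (X × StrongDual ℝ X) :=
  {p | p.1 ∈ C ∧ ∀ c ∈ C, p.2 (c - p.1) ≤ 0}

/-- The graph of the pointwise sum `x ↦ A x + B x`. -/
def sumGraph (A B : Set (X × StrongDual ℝ X)) : Set (X × StrongDual ℝ X) :=
  {p | ∃ u v : StrongDual ℝ X, (p.1, u) ∈ A ∧ (p.1, v) ∈ B ∧ p.2 = u + v}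

/-- The support function `σ_C`. -/
def supportFun (C : Set X) (u : StrongDual ℝ X) : EReal :=
  ⨆ c ∈ C, ((u c : ℝ) : EReal)

open Classical in
/-- The indicator function `ι_C`. -/
def indicatorFun (C : Set X) (x : X) : EReal :=
  if x ∈ C then 0 else ⊤

/-- The Fitzpatrick function
`F_A (x, x*) = sup_{(a, a*) ∈ gra A} (⟨x, a*⟩ + ⟨a, x*⟩ - ⟨a, a*⟩)`. -/
def fitzpatrick (A : Set (X × StrongDual ℝ X)) (p : X × StrongDual ℝ X) : EReal :=
  ⨆ q ∈ A, ((q.2 p.1 + p.2 q.1 - q.2 q.1 : ℝ) : EReal)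

/-- The Fenchel conjugate of a function on `X × X*`, evaluated at `(x*, x) ∈ X* × X`
(with `X` regarded as a subspace of `X**`, and equal to it when `X` is reflexive). -/
def conj (F : X × StrongDual ℝ X → EReal) (p : StrongDual ℝ X × X) : EReal :=
  ⨆ q : X × StrongDual ℝ X, ((p.1 q.1 + q.2 p.2 : ℝ) : EReal) - F q

/-- The partial inf-convolution `F₁ □₂ F₂`, in the second variable. -/
def partialInfConv {Y : Type*} [NormedAddCommGroup Y] (F₁ F₂ : X × Y → EReal)
    (p : X × Y) : EReal :=
  ⨅ v : Y, F₁ (p.1, p.2 - v) + F₂ (p.1, v)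

/-- `dom F`, the set of points where `F` is finite. -/
def effDom {Z : Type*} (F : Z → EReal) : Set Z := {z | F z ≠ ⊥ ∧ F z ≠ ⊤}

/-- `pos F`, the set of points where `F (x, x*) = ⟨x, x*⟩`. -/
def pos (F : X × StrongDual ℝ X → EReal) : Set (X × StrongDual ℝ X) :=
  {p | F p = ((p.2 p.1 : ℝ) : EReal)}

/-- BC-functions: proper convex functions `F : X × X* → ]-∞, +∞]` such that
`F* (x*, x) ≥ F (x, x*) ≥ ⟨x, x*⟩`. Convexity is convexity of the epigraph. -/
structure IsBCFunction (F : X × StrongDual ℝ X → EReal) : Prop where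
  ne_bot : ∀ p, F p ≠ ⊥
  proper : (effDom F).Nonempty
  convex : Convex ℝ {z : (X × StrongDual ℝ X) × ℝ | F z.1 ≤ (z.2 : EReal)}
  le_conj : ∀ (x : X) (u : StrongDual ℝ X), F (x, u) ≤ conj F (u, x)
  pairing_le : ∀ (x : X) (u : StrongDual ℝ X), ((u x : ℝ) : EReal) ≤ F (x, u)

/-- The hypotheses of the Brezis-Crandall-Pazy-type problem on `F₁`, `F₂` and
`j : [0, +∞[ → [0, +∞[`. -/
structure ProblemHypotheses (j : ℝ≥0 → ℝ≥0) (F₁ F₂ : X × StrongDual ℝ X → EReal) :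
    Prop where
  bc₁ : IsBCFunction F₁
  bc₂ : IsBCFunction F₂
  lsc₁ : LowerSemicontinuous F₁
  lsc₂ : LowerSemicontinuous F₂
  dom_inter : (Prod.fst '' effDom F₁ ∩ Prod.fst '' effDom F₂).Nonempty
  j_mono : Monotone j
  growth : ∀ (x : X) (u : StrongDual ℝ X) (y : X) (v : StrongDual ℝ X),
    (x, u) ∈ pos F₁ → (y, v) ∈ pos F₂ → x ≠ y → v (x - y) = ‖x - y‖ * ‖v‖ →
      ‖v‖₊ ≤ j (‖x‖₊ + ‖u + v‖₊ + ‖y‖₊ + ‖x - y‖₊ * ‖v‖₊)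

/-- The conclusion that the problem asks for: for all `(z, z*)` there is `v*` with
`F₁* (v*, z) + F₂* (z* - v*, z) ≤ (F₁ □₂ F₂)* (z*, z)`. -/
def ProblemConclusion (F₁ F₂ : X × StrongDual ℝ X → EReal) : Prop :=
  ∀ (z : X) (w : StrongDual ℝ X), ∃ v : StrongDual ℝ X,
    conj F₁ (v, z) + conj F₂ (w - v, z) ≤ conj (partialInfConv F₁ F₂) (w, z)

end General

/-- The affirmative answer to the Brezis-Crandall-Pazy-type problem, on all real reflexive
Banach spaces. -/
def ProblemAffirmative : Prop :=
  ∀ (X : Type) [NormedAddCommGroup X] [NormedSpace ℝ X] [CompleteSpace X],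
    IsReflexive X →
    ∀ (F₁ F₂ : X × StrongDual ℝ X → EReal) (j : ℝ≥0 → ℝ≥0),
      ProblemHypotheses j F₁ F₂ → ProblemConclusion F₁ F₂

/-! ### The concrete objects on `ℓ²` -/

/-- The real Hilbert space `ℓ²`; the coordinates are indexed from `0`. -/
abbrev Ell2 : Type := lp (fun _ : ℕ => ℝ) 2

/-- The graph of `A x = (∑_{i < n} x_i + x_n / 2)_n`, with domain the set of `x ∈ ℓ²` whose series
converges (as the limit of its partial sums) to `0` and whose sequence of partial sums is in `ℓ²`.
Here `ℓ²` is identified with its dual by the Riesz isometry. -/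
def graphA : Set (Ell2 × StrongDual ℝ Ell2) :=
  {p | Tendsto (fun N : ℕ => ∑ i ∈ Finset.range N, p.1 i) atTop (𝓝 0) ∧
    Memℓp (fun n : ℕ => ∑ i ∈ Finset.range (n + 1), p.1 i) 2 ∧
    ∃ y : Ell2, (∀ n : ℕ, y n = ∑ i ∈ Finset.range n, p.1 i + p.1 n / 2) ∧
      p.2 = InnerProductSpace.toDual ℝ Ell2 y}

/-- The first unit vector `e₁`. -/
def e₁ : Ell2 := lp.single 2 0 (1 : ℝ)

/-- `C = [0, e₁]`. -/
def segC : Set Ell2 := segment ℝ 0 e₁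

/-- The graph of `A*`. -/
def graphAstar : Set (Ell2 × StrongDual ℝ Ell2) := adjointGraph graphA

/-- `F_{A*}`. -/
def FAstar : Ell2 × StrongDual ℝ Ell2 → EReal := fitzpatrick graphAstar

/-- `F_{N_C}`. -/
def FNC : Ell2 × StrongDual ℝ Ell2 → EReal := fitzpatrick (normalConeGraph segC)

end FCP

end

namespace FCP

/-! ### Fitzpatrick functions of maximally monotone graphs -/

section Fitzpatrick

variable {X : Type*} [NormedAddCommGroup X] [NormedSpace ℝ X] {A : Set (X × StrongDual ℝ X)}

/-! Write `R` and `L` for the right and left shifts. Partial sums `s` parametrise gra A by `(s - R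
s, (s + R s)/2)`; since `L` is the adjoint of `R`, tail sums `r` parametrise gra A* by `(r - L r, (r
+ L r)/2)` (`mem_graphAstar_iff`). The pairing there is `(‖r‖² - ‖L r‖²)/2 = r₀²/2`: A* is monotone,
yet its pairing vanishes on all `r` with `r₀ = 0`. This degeneracy makes `F_{A*}` infinite off gra
A* (`FAstar_eq_top`), so the infimum in the partial inf-convolution has at most one finite term.

At `(A* e₁, 0)` the conjugate of the inf-convolution is bounded by the maximum 1/8 of `t/2 - t²/2`.
In the sum of conjugates, `F* ≥ F` forces the first functional to be `A* 0 = 0`, and the second term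
is then at least `σ_C(A* e₁) ≥ 1/2`. The growth condition holds because alignment forces `L r = 0`
(`shiftLeft_eq_zero_of_aligned`), hence `y = r` and `y* = r/2`. -/

lemma fitzpatrick_le_pairing (hA : IsMonotone A) {p : X × StrongDual ℝ X} (hp : p ∈ A) :
    fitzpatrick A p ≤ ((p.2 p.1 : ℝ) : EReal) := by
  refine iSup₂_le fun q hq => EReal.coe_le_coe_iff.2 ?_
  have h := hA p hp q hq
  simp only [sub_apply, map_sub] at h
  linarith

lemma le_fitzpatrick {q : X × StrongDual ℝ X} (hq : q ∈ A) (p : X × StrongDual ℝ X) :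
    ((q.2 p.1 + p.2 q.1 - q.2 q.1 : ℝ) : EReal) ≤ fitzpatrick A p :=
  le_iSup₂ (f := fun (q : X × StrongDual ℝ X) (_ : q ∈ A) =>
    ((q.2 p.1 + p.2 q.1 - q.2 q.1 : ℝ) : EReal)) q hq

lemma fitzpatrick_eq_pairing (hA : IsMonotone A) {p : X × StrongDual ℝ X} (hp : p ∈ A) :
    fitzpatrick A p = ((p.2 p.1 : ℝ) : EReal) := by
  refine (fitzpatrick_le_pairing hA hp).antisymm ?_
  simpa using le_fitzpatrick hp p

/-- On `A` the Fitzpatrick function is the pairing, so each affine piece defining it is also a term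
of the conjugate. -/
lemma fitzpatrick_le_conj (hA : IsMonotone A) (x : X) (u : StrongDual ℝ X) :
    fitzpatrick A (x, u) ≤ conj (fitzpatrick A) (u, x) := by
  refine iSup₂_le fun q hq => ?_
  refine le_trans ?_ (le_iSup _ q)
  rw [fitzpatrick_eq_pairing hA hq, ← EReal.coe_sub]
  exact EReal.coe_le_coe_iff.2 (by linarith)

lemma IsMaximallyMonotone.mem_of_forall (hA : IsMaximallyMonotone A) {p : X × StrongDual ℝ X}
    (hp : ∀ q ∈ A, 0 ≤ (p.2 - q.2) (p.1 - q.1)) : p ∈ A := by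
  have h : insert p A = A := by
    refine hA.2 _ ?_ (subset_insert _ _)
    rintro a (rfl | ha) b (rfl | hb)
    · simp
    · exact hp b hb
    · have := hp a ha
      rw [← neg_sub, ← neg_sub b.1, map_neg, neg_apply, neg_neg]
      exact this
    · exact hA.1 a ha b hb
  exact h ▸ mem_insert p A

lemma isMaximallyMonotone_of_forall (hA : IsMonotone A)
    (h : ∀ p : X × StrongDual ℝ X, (∀ q ∈ A, 0 ≤ (p.2 - q.2) (p.1 - q.1)) → p ∈ A) :
    IsMaximallyMonotone A :=
  ⟨hA, fun _ hB hAB => Subset.antisymm (fun p hp => h p fun q hq => hB p hp q (hAB hq)) hAB⟩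

/-- A point violating the bound would be monotonically related to `A`, hence in `A`, where equality
holds. -/
lemma pairing_le_fitzpatrick (hA : IsMaximallyMonotone A) (p : X × StrongDual ℝ X) :
    ((p.2 p.1 : ℝ) : EReal) ≤ fitzpatrick A p := by
  by_contra! h
  have hp : p ∈ A := hA.mem_of_forall fun q hq => by
    have h' := EReal.coe_lt_coe_iff.1 ((le_fitzpatrick hq p).trans_lt h)
    simp only [sub_apply, map_sub]
    linarith
  exact h.ne (fitzpatrick_eq_pairing hA.1 hp)

lemma convex_epigraph_fitzpatrick (A : Set (X × StrongDual ℝ X)) :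
    Convex ℝ {z : (X × StrongDual ℝ X) × ℝ | fitzpatrick A z.1 ≤ (z.2 : EReal)} := by
  have key : ∀ z : (X × StrongDual ℝ X) × ℝ, fitzpatrick A z.1 ≤ (z.2 : EReal) ↔
      ∀ q ∈ A, q.2 z.1.1 + z.1.2 q.1 - q.2 q.1 ≤ z.2 := fun z => by
    simp only [fitzpatrick, iSup_le_iff, EReal.coe_le_coe_iff]
  intro z hz w hw a b ha hb hab
  simp only [mem_ofPred_eq, key] at hz hw ⊢
  intro q hq
  have h₁ := mul_le_mul_of_nonneg_left (hz q hq) ha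
  have h₂ := mul_le_mul_of_nonneg_left (hw q hq) hb
  have h₃ : q.2 q.1 = a * q.2 q.1 + b * q.2 q.1 := by rw [← add_mul, hab, one_mul]
  simp only [Prod.fst_add, Prod.smul_fst, Prod.snd_add, Prod.smul_snd, map_add, map_smul,
    add_apply, smul_apply, smul_eq_mul]
  linarith

lemma lowerSemicontinuous_fitzpatrick (A : Set (X × StrongDual ℝ X)) :
    LowerSemicontinuous (fitzpatrick A) := by
  refine lowerSemicontinuous_biSup fun q _ => Continuous.lowerSemicontinuous ?_
  refine continuous_coe_real_ereal.comp ?_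
  have h : Continuous fun p : X × StrongDual ℝ X => p.2 q.1 :=
    (ContinuousLinearMap.apply ℝ ℝ q.1).continuous.comp continuous_snd
  fun_prop

lemma fitzpatrick_ne_bot (hA : A.Nonempty) (p : X × StrongDual ℝ X) : fitzpatrick A p ≠ ⊥ :=
  let ⟨_, hq⟩ := hA
  ((EReal.bot_lt_coe _).trans_le (le_fitzpatrick hq p)).ne'

lemma mem_effDom_fitzpatrick (hA : IsMonotone A) {p : X × StrongDual ℝ X} (hp : p ∈ A) :
    p ∈ effDom (fitzpatrick A) := by
  simp only [effDom, mem_ofPred_eq, fitzpatrick_eq_pairing hA hp]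
  exact ⟨EReal.coe_ne_bot _, EReal.coe_ne_top _⟩

lemma isBCFunction_fitzpatrick (hA : IsMaximallyMonotone A) (hne : A.Nonempty) :
    IsBCFunction (fitzpatrick A) where
  ne_bot := fitzpatrick_ne_bot hne
  proper := hne.mono fun _ hp => mem_effDom_fitzpatrick hA.1 hp
  convex := convex_epigraph_fitzpatrick A
  le_conj := fitzpatrick_le_conj hA.1
  pairing_le x u := pairing_le_fitzpatrick hA (x, u)

/-! ### Normal cones and sums of graphs -/

lemma isMonotone_normalConeGraph (C : Set X) : IsMonotone (normalConeGraph C) := by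
  rintro ⟨x, u⟩ ⟨hx, hu⟩ ⟨y, v⟩ ⟨hy, hv⟩
  have h₁ := hu y hy
  have h₂ := hv x hx
  simp only [sub_apply, map_sub] at *
  linarith

lemma isMonotone_sumGraph {B : Set (X × StrongDual ℝ X)} (hA : IsMonotone A) (hB : IsMonotone B) :
    IsMonotone (sumGraph A B) := by
  rintro ⟨x, u⟩ ⟨a, b, ha, hb, rfl⟩ ⟨y, v⟩ ⟨c, d, hc, hd, rfl⟩
  have h₁ := hA _ ha _ hc
  have h₂ := hB _ hb _ hd
  simp only [sub_apply, add_apply] at *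
  linarith

lemma zero_mem_normalConeGraph {C : Set X} {x : X} (hx : x ∈ C) :
    (x, (0 : StrongDual ℝ X)) ∈ normalConeGraph C :=
  ⟨hx, by simp⟩

lemma smul_mem_normalConeGraph {C : Set X} {x : X} {u : StrongDual ℝ X} {t : ℝ} (ht : 0 ≤ t)
    (h : (x, u) ∈ normalConeGraph C) : (x, t • u) ∈ normalConeGraph C :=
  ⟨h.1, fun c hc => mul_nonpos_of_nonneg_of_nonpos ht (h.2 c hc)⟩

end Fitzpatrick

lemma partialInfConv_comm {X Y : Type*} [NormedAddCommGroup Y] (F₁ F₂ : X × Y → EReal) :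
    partialInfConv F₁ F₂ = partialInfConv F₂ F₁ := by
  funext p
  refine (Equiv.subLeft p.2).iInf_congr fun v => ?_
  simp [add_comm]

lemma eq_top_of_forall_mul_le {a : EReal} {s t : ℝ} (hs : 0 < s)
    (h : ∀ r : ℝ, 0 ≤ r → ((r * s + t : ℝ) : EReal) ≤ a) : a = ⊤ := by
  refine EReal.eq_top_iff_forall_lt a |>.2 fun y => ?_
  refine lt_of_lt_of_le (EReal.coe_lt_coe_iff.2 ?_) (h ((|y - t| + 1) / s) (by positivity))
  rw [div_mul_cancel₀ _ hs.ne']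
  linarith [le_abs_self (y - t)]

/-! ### Hilbert spaces -/

section Hilbert

open InnerProductSpace

variable {H : Type*} [NormedAddCommGroup H] [InnerProductSpace ℝ H] [CompleteSpace H]

lemma isReflexive_of_hilbert : IsReflexive H := by
  intro φ
  refine ⟨(toDual ℝ H).symm
    (φ.comp (toDual ℝ H).toLinearIsometry.toContinuousLinearMap), ?_⟩
  ext u
  obtain ⟨w, rfl⟩ := (toDual ℝ H).surjective u
  rw [NormedSpace.dual_def, toDual_apply_apply, real_inner_comm, toDual_symm_apply]
  rfl

/-- The easy half of Minty's theorem. -/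
lemma isMaximallyMonotone_of_surjective {B : Set (H × StrongDual ℝ H)} (hB : IsMonotone B)
    (h : ∀ w : H, ∃ x y : H, (x, toDual ℝ H y) ∈ B ∧ x + y = w) : IsMaximallyMonotone B := by
  refine isMaximallyMonotone_of_forall hB ?_
  rintro ⟨x, u⟩ hp
  obtain ⟨w, rfl⟩ := (toDual ℝ H).surjective u
  -- With `c + n = x + w`, the monotonicity inequality against `(c, n)` becomes `0 ≤ -‖x - c‖²`.
  obtain ⟨c, n, hc, hsum⟩ := h (x + w)
  have h₁ := hp _ hc
  have h₂ : w - n = -(x - c) := by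
    rw [neg_sub, sub_eq_sub_iff_add_eq_add, add_comm w, hsum]
  rw [← map_sub, toDual_apply_apply, h₂, inner_neg_left, real_inner_self_eq_norm_sq] at h₁
  have h₃ : x - c = 0 := by
    rw [← norm_eq_zero, ← sq_eq_zero_iff]
    exact le_antisymm (by linarith) (sq_nonneg _)
  obtain rfl : x = c := sub_eq_zero.1 h₃
  obtain rfl : n = w := add_left_cancel hsum
  exact hc

lemma exists_projection {C : Set H} (hne : C.Nonempty) (hcl : IsClosed C) (hcv : Convex ℝ C)
    (w : H) : ∃ c, (c, toDual ℝ H (w - c)) ∈ normalConeGraph C := by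
  obtain ⟨c, hc, h⟩ := exists_norm_eq_iInf_of_complete_convex hne hcl.isComplete hcv w
  exact ⟨c, hc, fun d hd => (norm_eq_iInf_iff_real_inner_le_zero hcv hc).1 h d hd⟩

lemma isMaximallyMonotone_normalConeGraph {C : Set H} (hne : C.Nonempty) (hcl : IsClosed C)
    (hcv : Convex ℝ C) : IsMaximallyMonotone (normalConeGraph C) :=
  isMaximallyMonotone_of_surjective (isMonotone_normalConeGraph C) fun w =>
    let ⟨c, hc⟩ := exists_projection hne hcl hcv w
    ⟨c, w - c, hc, by abel⟩

lemma fitzpatrick_normalConeGraph {C : Set H} (hne : C.Nonempty) (hcl : IsClosed C)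
    (hcv : Convex ℝ C) (x : H) (u : StrongDual ℝ H) :
    fitzpatrick (normalConeGraph C) (x, u) = indicatorFun C x + supportFun C u := by
  by_cases hx : x ∈ C
  · rw [indicatorFun, if_pos hx, zero_add]
    refine le_antisymm (iSup₂_le ?_) (iSup₂_le fun c hc => ?_)
    · rintro ⟨c, n⟩ ⟨hc, hn⟩
      refine le_trans (EReal.coe_le_coe_iff.2 ?_)
        (le_iSup₂ (f := fun (c : H) (_ : c ∈ C) => ((u c : ℝ) : EReal)) c hc)
      have := hn x hx
      rw [map_sub] at this
      dsimp only at *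
      linarith
    · simpa using le_fitzpatrick (zero_mem_normalConeGraph hc) (x, u)
  · have hsup : supportFun C u ≠ ⊥ := by
      obtain ⟨c, hc⟩ := hne
      exact ((EReal.bot_lt_coe _).trans_le
        (le_iSup₂ (f := fun (c : H) (_ : c ∈ C) => ((u c : ℝ) : EReal)) c hc)).ne'
    rw [indicatorFun, if_neg hx, EReal.top_add_of_ne_bot hsup]
    -- The whole ray of normals `r • (x - c)`, `r ≥ 0`, at the projection `c` of `x` gives the
    -- values `r‖x - c‖² + u c`, which are unbounded.
    obtain ⟨c, hc⟩ := exists_projection hne hcl hcv x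
    have hpos : 0 < ‖x - c‖ ^ 2 := by
      have : x - c ≠ 0 := fun h => hx (sub_eq_zero.1 h ▸ hc.1)
      positivity
    refine eq_top_of_forall_mul_le (t := u c) hpos fun r hr => ?_
    refine le_trans (le_of_eq ?_) (le_fitzpatrick (smul_mem_normalConeGraph hr hc) (x, u))
    congr 1
    simp only [smul_apply, smul_eq_mul, toDual_apply_apply]
    rw [← real_inner_self_eq_norm_sq, inner_sub_right (x - c) x c]
    ring

end Hilbert

end FCP

namespace FCP

open InnerProductSpace

open scoped RealInnerProductSpace

/-! ### The shifts on `ℓ²` -/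

lemma memℓp_two_iff {f : ℕ → ℝ} : Memℓp f 2 ↔ Summable fun n => f n ^ 2 := by
  rw [memℓp_gen_iff (by norm_num)]
  simp

/-- The left shift. -/
def shiftLeft (x : Ell2) : Ell2 :=
  ⟨fun n => x (n + 1), memℓp_two_iff.2 ((summable_nat_add_iff 1).2 (memℓp_two_iff.1 x.2))⟩

/-- The right shift. -/
def shiftRight (x : Ell2) : Ell2 :=
  ⟨fun n => Nat.casesOn n 0 fun k => x k,
    memℓp_two_iff.2 ((summable_nat_add_iff (f := fun n => (Nat.casesOn n 0 fun k => x k : ℝ) ^ 2)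
      1).1 (memℓp_two_iff.1 x.2))⟩

@[simp] lemma shiftLeft_apply (x : Ell2) (n : ℕ) : shiftLeft x n = x (n + 1) := rfl

@[simp] lemma shiftRight_zero (x : Ell2) : shiftRight x 0 = 0 := rfl

@[simp] lemma shiftRight_succ (x : Ell2) (n : ℕ) : shiftRight x (n + 1) = x n := rfl

lemma shiftLeft_smul (t : ℝ) (x : Ell2) : shiftLeft (t • x) = t • shiftLeft x := rfl

lemma shiftLeft_add (x y : Ell2) : shiftLeft (x + y) = shiftLeft x + shiftLeft y := rfl

lemma shiftLeft_sub (x y : Ell2) : shiftLeft (x - y) = shiftLeft x - shiftLeft y := by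
  ext n
  simp

lemma shiftLeft_shiftRight (x : Ell2) : shiftLeft (shiftRight x) = x := by
  ext n
  simp

lemma hasSum_mul (x y : Ell2) : HasSum (fun n => x n * y n) ⟪x, y⟫ := by
  simpa only [real_inner_comm, RCLike.inner_apply, conj_trivial, mul_comm] using
    lp.hasSum_inner (𝕜 := ℝ) x y

lemma inner_eq_zero_add (x y : Ell2) : ⟪x, y⟫ = x 0 * y 0 + ⟪shiftLeft x, shiftLeft y⟫ := by
  rw [← (hasSum_mul x y).tsum_eq, (hasSum_mul x y).summable.tsum_eq_zero_add,
    ← (hasSum_mul (shiftLeft x) (shiftLeft y)).tsum_eq]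
  simp only [shiftLeft_apply]

lemma inner_shiftRight (x y : Ell2) : ⟪x, shiftRight y⟫ = ⟪shiftLeft x, y⟫ := by
  simp [inner_eq_zero_add x, shiftLeft_shiftRight]

lemma norm_sq_eq_zero_add (x : Ell2) : ‖x‖ ^ 2 = x 0 ^ 2 + ‖shiftLeft x‖ ^ 2 := by
  rw [← real_inner_self_eq_norm_sq, ← real_inner_self_eq_norm_sq, inner_eq_zero_add, sq]

lemma tendsto_zero_of_mem_ell2 (x : Ell2) : Tendsto x atTop (𝓝 0) := by
  refine (tendsto_zero_iff_abs_tendsto_zero _).2 ?_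
  have h := (Real.continuous_sqrt.tendsto 0).comp (memℓp_two_iff.1 x.2).tendsto_atTop_zero
  rw [Real.sqrt_zero] at h
  exact h.congr fun n => Real.sqrt_sq_eq_abs _

/-- The moduli increase to the limit 0. Both the single-valuedness of A* and the growth condition
rest on this. -/
lemma eq_zero_of_abs_le_succ {x : Ell2} (h : ∀ n, |x n| ≤ |x (n + 1)|) : x = 0 := by
  ext n
  have hm : Monotone fun n => |x n| := monotone_nat_of_le_succ h
  have ht : Tendsto (fun n => |x n|) atTop (𝓝 0) := by
    simpa using (tendsto_zero_of_mem_ell2 x).abs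
  exact abs_nonpos_iff.1 (hm.ge_of_tendsto ht n)

/-! ### The graph of the adjoint -/

/-- Here `s` is the sequence of partial sums including the current term and `shiftRight s` the one
excluding it. -/
lemma mem_graphA_of_sums (s : Ell2) :
    (s - shiftRight s, toDual ℝ Ell2 ((1 / 2 : ℝ) • (s + shiftRight s))) ∈ graphA := by
  have hsum : ∀ n, ∑ i ∈ Finset.range n, (s - shiftRight s) i = shiftRight s n := by
    intro n
    induction n with
    | zero => simp
    | succ n ih => rw [Finset.sum_range_succ, ih]; simp
  refine ⟨?_, ?_, _, fun n => ?_, rfl⟩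
  · simp only [hsum]
    exact tendsto_zero_of_mem_ell2 _
  · simp only [hsum]
    exact s.2
  · rw [hsum]
    simp only [lp.coeFn_smul, lp.coeFn_add, lp.coeFn_sub, Pi.smul_apply, Pi.add_apply,
      Pi.sub_apply, smul_eq_mul]
    ring

lemma exists_sums_of_mem_graphA {q : Ell2 × StrongDual ℝ Ell2} (hq : q ∈ graphA) :
    ∃ s : Ell2, q = (s - shiftRight s, toDual ℝ Ell2 ((1 / 2 : ℝ) • (s + shiftRight s))) := by
  obtain ⟨a, u⟩ := q
  obtain ⟨-, hs, y, hy, rfl⟩ := hq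
  obtain ⟨s, hs⟩ : ∃ s : Ell2, ∀ n, s n = ∑ i ∈ Finset.range (n + 1), a i :=
    ⟨⟨_, hs⟩, fun _ => rfl⟩
  refine ⟨s, Prod.ext ?_ (congrArg (toDual ℝ Ell2) ?_)⟩ <;> ext n <;> cases n
  · simp [hs]
  · simp [hs, Finset.sum_range_succ]
  · simp only [hy, hs, lp.coeFn_smul, lp.coeFn_add, Pi.smul_apply, Pi.add_apply, smul_eq_mul,
      shiftRight_zero, Finset.sum_range_succ, Finset.sum_range_zero]
    ring
  · simp only [hy, hs, lp.coeFn_smul, lp.coeFn_add, Pi.smul_apply, Pi.add_apply, smul_eq_mul,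
      shiftRight_succ, Finset.sum_range_succ]
    ring

/-- Moving the shift off `s` leaves one vector paired with an arbitrary `s`, so the adjoint relation
says that this vector is zero. -/
lemma pairing_graphA (x w s : Ell2) :
    ⟪w, s - shiftRight s⟫ - ⟪(1 / 2 : ℝ) • (s + shiftRight s), x⟫ =
      ⟪w - (1 / 2 : ℝ) • x - shiftLeft (w + (1 / 2 : ℝ) • x), s⟫ := by
  rw [inner_sub_left _ _ s, ← inner_shiftRight, real_inner_comm x]
  simp only [inner_add_left, inner_sub_left, inner_sub_right, inner_add_right, inner_smul_left,
    inner_smul_right, RCLike.conj_to_real]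
  ring

lemma mem_graphAstar_iff {x w : Ell2} : (x, toDual ℝ Ell2 w) ∈ graphAstar ↔
    shiftLeft (w + (1 / 2 : ℝ) • x) = w - (1 / 2 : ℝ) • x := by
  have key : (x, toDual ℝ Ell2 w) ∈ graphAstar ↔
      ∀ s : Ell2, ⟪w - (1 / 2 : ℝ) • x - shiftLeft (w + (1 / 2 : ℝ) • x), s⟫ = 0 := by
    simp only [← pairing_graphA]
    refine ⟨fun h s => ?_, fun h q hq => ?_⟩
    · have := h _ (mem_graphA_of_sums s)
      rwa [toDual_apply_apply, toDual_apply_apply, inner_neg_right, ← sub_eq_add_neg] at this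
    · obtain ⟨s, rfl⟩ := exists_sums_of_mem_graphA hq
      rw [toDual_apply_apply, toDual_apply_apply, inner_neg_right, ← sub_eq_add_neg]
      exact h s
  rw [key]
  refine ⟨fun h => (sub_eq_zero.1 (inner_self_eq_zero.1 (h _))).symm, fun h s => ?_⟩
  rw [h, sub_self, inner_zero_left]

/-- In `mem_graphAstar_iff`, put `r = w + x/2`; the condition then reads `w - x/2 = shiftLeft r`. As
`r` tends to 0, telescoping shows that `r` is the sequence of tail sums of `x`. -/
lemma mem_graphAstar_of_tails (r : Ell2) :
    (r - shiftLeft r, toDual ℝ Ell2 ((1 / 2 : ℝ) • (r + shiftLeft r))) ∈ graphAstar := by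
  refine mem_graphAstar_iff.2 ?_
  have h₁ : (1 / 2 : ℝ) • (r + shiftLeft r) + (1 / 2 : ℝ) • (r - shiftLeft r) = r := by module
  have h₂ : (1 / 2 : ℝ) • (r + shiftLeft r) - (1 / 2 : ℝ) • (r - shiftLeft r) = shiftLeft r := by
    module
  rw [h₁, h₂]

lemma exists_tails_of_mem_graphAstar {x w : Ell2} (h : (x, toDual ℝ Ell2 w) ∈ graphAstar) :
    ∃ r, x = r - shiftLeft r ∧ w = (1 / 2 : ℝ) • (r + shiftLeft r) := by
  refine ⟨w + (1 / 2 : ℝ) • x, ?_, ?_⟩ <;> rw [mem_graphAstar_iff.1 h] <;> module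

/-! ### Monotonicity of A* and its Fitzpatrick function -/

lemma inner_half_add_sub (r l : Ell2) :
    ⟪(1 / 2 : ℝ) • (r + l), r - l⟫ = (‖r‖ ^ 2 - ‖l‖ ^ 2) / 2 := by
  rw [inner_smul_left, inner_add_left, inner_sub_right, inner_sub_right, real_inner_comm r l,
    real_inner_self_eq_norm_sq, real_inner_self_eq_norm_sq, RCLike.conj_to_real]
  ring

lemma graphAstar_sub {p q : Ell2 × StrongDual ℝ Ell2} (hp : p ∈ graphAstar)
    (hq : q ∈ graphAstar) : p - q ∈ graphAstar := fun a ha => by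
  have h₁ := hp a ha
  have h₂ := hq a ha
  simp only [Prod.fst_sub, Prod.snd_sub, sub_apply, map_neg, map_sub] at *
  linarith

lemma pairing_nonneg_of_mem_graphAstar {p : Ell2 × StrongDual ℝ Ell2} (hp : p ∈ graphAstar) :
    0 ≤ p.2 p.1 := by
  obtain ⟨x, u⟩ := p
  obtain ⟨w, rfl⟩ := (toDual ℝ Ell2).surjective u
  obtain ⟨r, rfl, rfl⟩ := exists_tails_of_mem_graphAstar hp
  rw [toDual_apply_apply, inner_half_add_sub, norm_sq_eq_zero_add r]
  linarith [sq_nonneg (r 0)]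

lemma isMonotone_graphAstar : IsMonotone graphAstar := fun _ hp _ hq =>
  pairing_nonneg_of_mem_graphAstar (graphAstar_sub hp hq)

/-- By linearity the difference of two values is a `w` with `shiftLeft w = w`: a constant sequence
in ℓ², hence zero. -/
lemma graphAstar_unique {x : Ell2} {u v : StrongDual ℝ Ell2} (hu : (x, u) ∈ graphAstar)
    (hv : (x, v) ∈ graphAstar) : u = v := by
  have h := graphAstar_sub hu hv
  rw [Prod.mk_sub_mk, sub_self] at h
  obtain ⟨w, hw⟩ := (toDual ℝ Ell2).surjective (u - v)
  rw [← hw, mem_graphAstar_iff, smul_zero, add_zero, sub_zero] at h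
  have hw₀ : w = 0 := eq_zero_of_abs_le_succ fun n => by
    rw [← shiftLeft_apply, h]
  rw [hw₀, map_zero] at hw
  exact sub_eq_zero.1 hw.symm

lemma FAstar_eq_top {p : Ell2 × StrongDual ℝ Ell2} (hp : p ∉ graphAstar) : FAstar p = ⊤ := by
  obtain ⟨x, u⟩ := p
  obtain ⟨w, rfl⟩ := (toDual ℝ Ell2).surjective u
  set d : Ell2 := shiftLeft (w + (1 / 2 : ℝ) • x) - (w - (1 / 2 : ℝ) • x) with hd
  have hd₀ : 0 < ‖d‖ ^ 2 := by
    have : d ≠ 0 := fun h => hp (mem_graphAstar_iff.2 (sub_eq_zero.1 h))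
    positivity
  refine eq_top_of_forall_mul_le (t := 0) hd₀ fun t _ => ?_
  -- The tails `t • shiftRight d` vanish at index 0, so their quadratic term is zero and the
  -- remaining expression is `t‖d‖²`, linear in `t`.
  refine le_trans (le_of_eq ?_) (le_fitzpatrick (mem_graphAstar_of_tails (t • shiftRight d)) _)
  congr 1
  simp only [toDual_apply_apply]
  rw [inner_half_add_sub, norm_sq_eq_zero_add (t • shiftRight d), shiftLeft_smul,
    shiftLeft_shiftRight]
  have h₁ : ‖d‖ ^ 2 = ⟪w + (1 / 2 : ℝ) • x, shiftRight d⟫ - ⟪w - (1 / 2 : ℝ) • x, d⟫ := by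
    rw [inner_shiftRight, ← inner_sub_left, ← hd, real_inner_self_eq_norm_sq]
  rw [h₁, real_inner_comm x]
  simp only [inner_add_left, inner_sub_left, inner_sub_right, inner_add_right, inner_smul_left,
    inner_smul_right, RCLike.conj_to_real, lp.coeFn_smul, Pi.smul_apply, shiftRight_zero,
    smul_zero]
  ring

/-- A point monotonically related to the graph has `F_{A*}` bounded by its pairing, hence finite,
which happens only on the graph. -/
lemma isMaximallyMonotone_graphAstar : IsMaximallyMonotone graphAstar := by
  refine isMaximallyMonotone_of_forall isMonotone_graphAstar fun p hp => ?_
  by_contra h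
  have hle : FAstar p ≤ ((p.2 p.1 : ℝ) : EReal) := by
    refine iSup₂_le fun q hq => EReal.coe_le_coe_iff.2 ?_
    have := hp q hq
    simp only [sub_apply, map_sub] at this
    linarith
  rw [FAstar_eq_top h, top_le_iff] at hle
  exact EReal.coe_ne_top _ hle

lemma FAstar_eq_pairing {p : Ell2 × StrongDual ℝ Ell2} (hp : p ∈ graphAstar) :
    FAstar p = ((p.2 p.1 : ℝ) : EReal) :=
  fitzpatrick_eq_pairing isMonotone_graphAstar hp

lemma mem_graphAstar_of_mem_pos {p : Ell2 × StrongDual ℝ Ell2} (hp : p ∈ pos FAstar) :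
    p ∈ graphAstar := by
  by_contra h
  have hp' : FAstar p = ((p.2 p.1 : ℝ) : EReal) := hp
  rw [FAstar_eq_top h] at hp'
  exact EReal.coe_ne_top _ hp'.symm

lemma zero_mem_graphAstar : (0, 0) ∈ graphAstar := fun a _ => by simp

lemma isBCFunction_FAstar : IsBCFunction FAstar :=
  isBCFunction_fitzpatrick isMaximallyMonotone_graphAstar ⟨_, zero_mem_graphAstar⟩

/-! ### The segment `C` -/

lemma shiftLeft_e₁ : shiftLeft e₁ = 0 := by
  ext n
  simp [e₁]

@[simp] lemma e₁_zero : e₁ 0 = 1 := by simp [e₁]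

lemma norm_e₁ : ‖e₁‖ = 1 := by
  have h := norm_sq_eq_zero_add e₁
  rw [shiftLeft_e₁, e₁_zero, norm_zero] at h
  nlinarith [norm_nonneg e₁]

lemma inner_e₁_self : ⟪e₁, e₁⟫ = 1 := by
  rw [real_inner_self_eq_norm_sq, norm_e₁, one_pow]

lemma smul_e₁_mem_graphAstar (t : ℝ) :
    (t • e₁, toDual ℝ Ell2 ((t / 2) • e₁)) ∈ graphAstar := by
  have h := mem_graphAstar_of_tails (t • e₁)
  rw [shiftLeft_smul, shiftLeft_e₁, smul_zero, sub_zero, add_zero, smul_smul] at h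
  convert h using 3
  ring_nf

lemma mem_segC_iff {x : Ell2} : x ∈ segC ↔ ∃ t : ℝ, 0 ≤ t ∧ t ≤ 1 ∧ x = t • e₁ := by
  rw [segC, segment_eq_image]
  simp only [mem_image, mem_Icc, smul_zero, zero_add, and_assoc, eq_comm]

lemma zero_mem_segC : (0 : Ell2) ∈ segC := left_mem_segment ℝ _ _

lemma e₁_mem_segC : e₁ ∈ segC := right_mem_segment ℝ _ _

lemma isClosed_segC : IsClosed segC := by
  rw [segC, segment_eq_image]
  exact (isCompact_Icc.image (by fun_prop)).isClosed

lemma convex_segC : Convex ℝ segC := convex_segment _ _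

lemma FNC_eq (x : Ell2) (u : StrongDual ℝ Ell2) :
    FNC (x, u) = indicatorFun segC x + supportFun segC u :=
  fitzpatrick_normalConeGraph ⟨_, zero_mem_segC⟩ isClosed_segC convex_segC x u

lemma isBCFunction_FNC : IsBCFunction FNC :=
  isBCFunction_fitzpatrick
    (isMaximallyMonotone_normalConeGraph ⟨_, zero_mem_segC⟩ isClosed_segC convex_segC)
    ⟨_, zero_mem_normalConeGraph zero_mem_segC⟩

lemma supportFun_segC_nonneg (u : StrongDual ℝ Ell2) : 0 ≤ supportFun segC u := by
  refine le_trans (le_of_eq ?_)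
    (le_iSup₂ (f := fun (c : Ell2) (_ : c ∈ segC) => ((u c : ℝ) : EReal)) 0 zero_mem_segC)
  simp

lemma FNC_of_mem {x : Ell2} (hx : x ∈ segC) (u : StrongDual ℝ Ell2) :
    FNC (x, u) = supportFun segC u := by
  rw [FNC_eq, indicatorFun, if_pos hx, zero_add]

lemma FNC_of_notMem {x : Ell2} (hx : x ∉ segC) (u : StrongDual ℝ Ell2) : FNC (x, u) = ⊤ := by
  rw [FNC_eq, indicatorFun, if_neg hx, EReal.top_add_of_ne_bot]
  exact (EReal.bot_lt_zero.trans_le (supportFun_segC_nonneg u)).ne'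

lemma mem_segC_of_mem_pos {x : Ell2} {u : StrongDual ℝ Ell2} (h : (x, u) ∈ pos FNC) :
    x ∈ segC := by
  by_contra hx
  have h' : FNC (x, u) = ((u x : ℝ) : EReal) := h
  rw [FNC_of_notMem hx] at h'
  exact EReal.coe_ne_top _ h'.symm

lemma partialInfConv_of_mem {x : Ell2} (hx : x ∈ segC) (u : StrongDual ℝ Ell2)
    {a : StrongDual ℝ Ell2} (ha : (x, a) ∈ graphAstar) :
    partialInfConv FAstar FNC (x, u) = ((a x : ℝ) : EReal) + supportFun segC (u - a) := by
  refine le_antisymm (iInf_le_of_le (u - a) ?_) (le_iInf fun v => ?_)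
  · rw [sub_sub_cancel, FAstar_eq_pairing ha, FNC_of_mem hx]
  · by_cases hv : (x, u - v) ∈ graphAstar
    · obtain rfl := graphAstar_unique hv ha
      rw [FAstar_eq_pairing hv, FNC_of_mem hx, sub_sub_cancel]
    · rw [FAstar_eq_top hv, EReal.top_add_of_ne_bot (isBCFunction_FNC.ne_bot _)]
      exact le_top

lemma partialInfConv_of_notMem {x : Ell2} (hx : x ∉ segC) (u : StrongDual ℝ Ell2) :
    partialInfConv FAstar FNC (x, u) = ⊤ := by
  refine top_le_iff.1 (le_iInf fun v => ?_)
  rw [FNC_of_notMem hx, EReal.add_top_of_ne_bot (isBCFunction_FAstar.ne_bot _)]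

/-! ### The conjugates at `(A* e₁, 0)` -/

lemma eq_of_e₁_mem_graphAstar {a : StrongDual ℝ Ell2} (ha : (e₁, a) ∈ graphAstar) :
    a = toDual ℝ Ell2 ((1 / 2 : ℝ) • e₁) := by
  have h := smul_e₁_mem_graphAstar 1
  rw [one_smul] at h
  exact graphAstar_unique ha h

lemma conj_partialInfConv_le {a : StrongDual ℝ Ell2} (ha : (e₁, a) ∈ graphAstar) :
    conj (partialInfConv FAstar FNC) (a, 0) ≤ ((1 / 8 : ℝ) : EReal) := by
  refine iSup_le fun ⟨y, v⟩ => ?_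
  by_cases hy : y ∈ segC
  · obtain ⟨t, -, -, rfl⟩ := mem_segC_iff.1 hy
    have hle : ((t ^ 2 / 2 : ℝ) : EReal) ≤ partialInfConv FAstar FNC (t • e₁, v) := by
      rw [partialInfConv_of_mem hy v (smul_e₁_mem_graphAstar t)]
      refine le_trans (le_of_eq ?_) (le_add_of_nonneg_right (supportFun_segC_nonneg _))
      congr 1
      rw [toDual_apply_apply, inner_smul_left, inner_smul_right, inner_e₁_self,
        RCLike.conj_to_real]
      ring
    refine (EReal.sub_le_sub le_rfl hle).trans ?_
    rw [← EReal.coe_sub, EReal.coe_le_coe_iff, eq_of_e₁_mem_graphAstar ha]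
    simp only [toDual_apply_apply, inner_smul_left, inner_smul_right, inner_e₁_self, map_zero,
      RCLike.conj_to_real]
    -- What remains is `t/2 - t²/2 ≤ 1/8`, with equality at `t = 1/2`.
    nlinarith [sq_nonneg (t - 1 / 2)]
  · rw [partialInfConv_of_notMem hy, EReal.sub_top]
    exact bot_le

lemma half_le_conj_add_conj {a : StrongDual ℝ Ell2} (ha : (e₁, a) ∈ graphAstar)
    (u : StrongDual ℝ Ell2) :
    ((1 / 2 : ℝ) : EReal) ≤ conj FAstar (u, 0) + conj FNC (a - u, 0) := by
  have h₁ : FAstar (0, u) ≤ conj FAstar (u, 0) := isBCFunction_FAstar.le_conj 0 u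
  have h₂ : FNC (0, a - u) ≤ conj FNC (a - u, 0) := isBCFunction_FNC.le_conj 0 (a - u)
  -- Only `u = 0` keeps the first term finite; then testing the support function at `e₁` gives 1/2.
  by_cases hu : (0, u) ∈ graphAstar
  · obtain rfl := graphAstar_unique hu zero_mem_graphAstar
    rw [FAstar_eq_pairing hu, map_zero, EReal.coe_zero] at h₁
    refine le_trans ?_ (add_le_add h₁ (h₂))
    rw [zero_add, sub_zero, FNC_of_mem zero_mem_segC]
    refine le_trans (le_of_eq ?_)
      (le_iSup₂ (f := fun (c : Ell2) (_ : c ∈ segC) => ((a c : ℝ) : EReal)) e₁ e₁_mem_segC)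
    simp [eq_of_e₁_mem_graphAstar ha, norm_e₁]
  · rw [FAstar_eq_top hu, top_le_iff] at h₁
    have h₃ : conj FNC (a - u, 0) ≠ ⊥ :=
      ((isBCFunction_FNC.ne_bot (0, a - u)).bot_lt.trans_le h₂).ne'
    rw [h₁, EReal.top_add_of_ne_bot h₃]
    exact le_top

lemma conj_partialInfConv_lt {a : StrongDual ℝ Ell2} (ha : (e₁, a) ∈ graphAstar)
    (u : StrongDual ℝ Ell2) : conj (partialInfConv FAstar FNC) (a, 0) <
      conj FAstar (u, 0) + conj FNC (a - u, 0) :=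
  ((conj_partialInfConv_le ha).trans_lt (EReal.coe_lt_coe_iff.2 (by norm_num))).trans_le
    (half_le_conj_add_conj ha u)

/-! ### The growth condition -/

/-- Beyond index 0 the vector `e₁` disappears, leaving `(l + 1/2) r_{n+1} = (l - 1/2) r_{n+2}`.
Since `|l - 1/2| ≤ l + 1/2` for `l ≥ 0`, the moduli cannot decrease. -/
lemma shiftLeft_eq_zero_of_aligned {r : Ell2} {t l : ℝ} (hl : 0 ≤ l)
    (h : (1 / 2 : ℝ) • (r + shiftLeft r) = l • (t • e₁ - (r - shiftLeft r))) :
    shiftLeft r = 0 := by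
  refine eq_zero_of_abs_le_succ fun n => ?_
  have hn := congrArg (fun x : Ell2 => shiftLeft x n) h
  simp only [shiftLeft_smul, shiftLeft_add, shiftLeft_sub, shiftLeft_e₁, lp.coeFn_smul,
    lp.coeFn_add, lp.coeFn_sub, lp.coeFn_zero, Pi.smul_apply, Pi.add_apply, Pi.sub_apply,
    Pi.zero_apply, smul_eq_mul, shiftLeft_apply] at hn ⊢
  have h₁ : (l + 1 / 2) * r (n + 1) = (l - 1 / 2) * r (n + 1 + 1) := by linarith
  have h₂ : (l + 1 / 2) * |r (n + 1)| ≤ (l + 1 / 2) * |r (n + 1 + 1)| := by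
    calc (l + 1 / 2) * |r (n + 1)| = |(l + 1 / 2) * r (n + 1)| := by
          rw [abs_mul, abs_of_pos (show 0 < l + 1 / 2 by linarith)]
      _ = |l - 1 / 2| * |r (n + 1 + 1)| := by rw [h₁, abs_mul]
      _ ≤ _ := mul_le_mul_of_nonneg_right (abs_le.2 ⟨by linarith, by linarith⟩) (abs_nonneg _)
  exact le_of_mul_le_mul_left h₂ (by linarith)

lemma norm_le_half_norm {x y : Ell2} {u v : StrongDual ℝ Ell2} (hx : (x, u) ∈ pos FNC)
    (hy : (y, v) ∈ pos FAstar) (hne : x ≠ y) (h : v (x - y) = ‖x - y‖ * ‖v‖) :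
    ‖v‖ ≤ ‖y‖ / 2 := by
  obtain ⟨t, -, -, rfl⟩ := mem_segC_iff.1 (mem_segC_of_mem_pos hx)
  obtain ⟨w, rfl⟩ := (toDual ℝ Ell2).surjective v
  obtain ⟨r, rfl, rfl⟩ := exists_tails_of_mem_graphAstar (mem_graphAstar_of_mem_pos hy)
  rw [toDual_apply_apply, LinearIsometryEquiv.norm_map, real_inner_comm] at h
  -- Equality in Cauchy–Schwarz: `y*` is the nonnegative multiple `‖y*‖ / ‖x - y‖` of `x - y`.
  have hdir := (inner_eq_norm_mul_iff_div (𝕜 := ℝ) (sub_ne_zero.2 hne)).1 h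
  have hr := shiftLeft_eq_zero_of_aligned (by positivity) hdir.symm
  rw [LinearIsometryEquiv.norm_map, hr, add_zero, sub_zero, norm_smul]
  norm_num
  linarith

lemma growth_bound {j : ℝ≥0 → ℝ≥0} (hj : ∀ γ : ℝ≥0, γ / 2 ≤ j γ) {x y : Ell2}
    {u v : StrongDual ℝ Ell2} (hx : (x, u) ∈ pos FNC)
    (hy : (y, v) ∈ pos FAstar) (hne : x ≠ y) (h : v (x - y) = ‖x - y‖ * ‖v‖) :
    ‖v‖₊ ≤ ‖y‖₊ / 2 ∧ ‖y‖₊ / 2 ≤ j (‖x‖₊ + ‖u + v‖₊ + ‖y‖₊ + ‖x - y‖₊ * ‖v‖₊) := by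
  refine ⟨?_, le_trans ?_ (hj _)⟩
  · exact_mod_cast norm_le_half_norm hx hy hne h
  · gcongr
    rw [add_assoc]
    exact le_add_self.trans (add_le_add_right le_self_add _)

lemma problemHypotheses {j : ℝ≥0 → ℝ≥0} (hj_mono : Monotone j) (hj : ∀ γ : ℝ≥0, γ / 2 ≤ j γ) :
    ProblemHypotheses j FNC FAstar where
  bc₁ := isBCFunction_FNC
  bc₂ := isBCFunction_FAstar
  lsc₁ := lowerSemicontinuous_fitzpatrick _
  lsc₂ := lowerSemicontinuous_fitzpatrick _
  dom_inter := ⟨0,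
    ⟨_, mem_effDom_fitzpatrick (isMonotone_normalConeGraph _)
      (zero_mem_normalConeGraph zero_mem_segC), rfl⟩,
    ⟨_, mem_effDom_fitzpatrick isMonotone_graphAstar zero_mem_graphAstar, rfl⟩⟩
  j_mono := hj_mono
  growth _ _ _ _ hx hy hne h :=
    (growth_bound hj hx hy hne h).1.trans (growth_bound hj hx hy hne h).2

lemma not_problemConclusion : ¬ ProblemConclusion FNC FAstar := by
  intro h
  have ha := smul_e₁_mem_graphAstar 1
  rw [one_smul] at ha
  obtain ⟨v, hv⟩ := h 0 (toDual ℝ Ell2 ((1 / 2 : ℝ) • e₁))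
  have hlt := conj_partialInfConv_lt ha (toDual ℝ Ell2 ((1 / 2 : ℝ) • e₁) - v)
  rw [sub_sub_cancel, add_comm, partialInfConv_comm] at hlt
  exact hlt.not_ge hv

/-! ### The sum `A* + N_C` -/

/-- By Minty it suffices to solve `x + A* x + n = w` with `n` normal to `C` at `x`. On `C` the first
two terms add to `(3/2) x`, so `x` is the projection of `(2/3) w` onto `C`, and `n` is 3/2 times the
residual. -/
lemma isMaximallyMonotone_sum :
    IsMaximallyMonotone (sumGraph graphAstar (normalConeGraph segC)) := by
  refine isMaximallyMonotone_of_surjective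
    (isMonotone_sumGraph isMonotone_graphAstar (isMonotone_normalConeGraph _)) fun w => ?_
  obtain ⟨c, hc⟩ := exists_projection ⟨_, zero_mem_segC⟩ isClosed_segC convex_segC
    ((2 / 3 : ℝ) • w)
  obtain ⟨t, -, -, rfl⟩ := mem_segC_iff.1 hc.1
  refine ⟨t • e₁, (t / 2) • e₁ + (3 / 2 : ℝ) • ((2 / 3 : ℝ) • w - t • e₁),
    ⟨_, _, smul_e₁_mem_graphAstar t,
      smul_mem_normalConeGraph (by norm_num : (0 : ℝ) ≤ 3 / 2) hc, ?_⟩, by module⟩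
  simp only [map_add, map_smul]

end FCP

theorem mainTheorem3 (j : ℝ≥0 → ℝ≥0) (hj_mono : Monotone j) (hj : ∀ γ : ℝ≥0, γ / 2 ≤ j γ) :
    -- `A*` is defined and single-valued on `C`
    (∀ x ∈ FCP.segC, ∃! a : StrongDual ℝ FCP.Ell2, (x, a) ∈ FCP.graphAstar) ∧
    -- `F_{A*}` and `F_{N_C} = ι_C ⊕ σ_C` are BC-functions
    FCP.IsBCFunction FCP.FAstar ∧
    FCP.IsBCFunction FCP.FNC ∧
    (∀ (x : FCP.Ell2) (u : StrongDual ℝ FCP.Ell2),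
      FCP.FNC (x, u) = FCP.indicatorFun FCP.segC x + FCP.supportFun FCP.segC u) ∧
    -- the formula for `F_{A*} □₂ F_{N_C}`, where `a` stands for `A* x`
    (∀ (x : FCP.Ell2) (u : StrongDual ℝ FCP.Ell2),
      (x ∈ FCP.segC → ∀ a : StrongDual ℝ FCP.Ell2, (x, a) ∈ FCP.graphAstar →
        FCP.partialInfConv FCP.FAstar FCP.FNC (x, u) =
          ((a x : ℝ) : EReal) + FCP.supportFun FCP.segC (u - a)) ∧
      (x ∉ FCP.segC → FCP.partialInfConv FCP.FAstar FCP.FNC (x, u) = ⊤)) ∧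
    -- the strict inequality at `(A* e₁, 0)`, where `a` stands for `A* e₁`
    (∀ a : StrongDual ℝ FCP.Ell2, (FCP.e₁, a) ∈ FCP.graphAstar →
      FCP.conj (FCP.partialInfConv FCP.FAstar FCP.FNC) (a, 0) ≤ ((1 / 8 : ℝ) : EReal) ∧
      ∀ u : StrongDual ℝ FCP.Ell2,
        ((1 / 2 : ℝ) : EReal) ≤ FCP.conj FCP.FAstar (u, 0) + FCP.conj FCP.FNC (a - u, 0) ∧
        FCP.conj (FCP.partialInfConv FCP.FAstar FCP.FNC) (a, 0) <
          FCP.conj FCP.FAstar (u, 0) + FCP.conj FCP.FNC (a - u, 0)) ∧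
    -- the growth implication
    (∀ (x : FCP.Ell2) (u : StrongDual ℝ FCP.Ell2) (y : FCP.Ell2) (v : StrongDual ℝ FCP.Ell2),
      (x, u) ∈ FCP.pos FCP.FNC → (y, v) ∈ FCP.pos FCP.FAstar → x ≠ y →
      v (x - y) = ‖x - y‖ * ‖v‖ →
        ‖v‖₊ ≤ ‖y‖₊ / 2 ∧
        ‖y‖₊ / 2 ≤ j (‖x‖₊ + ‖u + v‖₊ + ‖y‖₊ + ‖x - y‖₊ * ‖v‖₊)) ∧
    -- `A* + N_C` is maximally monotone
    FCP.IsMaximallyMonotone (FCP.sumGraph FCP.graphAstar (FCP.normalConeGraph FCP.segC)) ∧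
    -- the pair `F_{N_C}`, `F_{A*}` is a counterexample, so the problem has a negative answer
    FCP.ProblemHypotheses j FCP.FNC FCP.FAstar ∧
    ¬ FCP.ProblemConclusion FCP.FNC FCP.FAstar ∧
    ¬ FCP.ProblemAffirmative := by
  refine ⟨fun x hx => ?_, FCP.isBCFunction_FAstar, FCP.isBCFunction_FNC, FCP.FNC_eq,
    fun x u => ⟨fun hx a ha => FCP.partialInfConv_of_mem hx u ha,
      fun hx => FCP.partialInfConv_of_notMem hx u⟩,
    fun a ha => ⟨FCP.conj_partialInfConv_le ha,
      fun u => ⟨FCP.half_le_conj_add_conj ha u, FCP.conj_partialInfConv_lt ha u⟩⟩,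
    fun x u y v hx hy hne h => FCP.growth_bound hj hx hy hne h,
    FCP.isMaximallyMonotone_sum, FCP.problemHypotheses hj_mono hj, FCP.not_problemConclusion,
    fun h => FCP.not_problemConclusion (h FCP.Ell2 FCP.isReflexive_of_hilbert FCP.FNC FCP.FAstar j
      (FCP.problemHypotheses hj_mono hj))⟩
  obtain ⟨t, -, -, rfl⟩ := FCP.mem_segC_iff.1 hx
  exact ⟨_, FCP.smul_e₁_mem_graphAstar t,
    fun b hb => FCP.graphAstar_unique hb (FCP.smul_e₁_mem_graphAstar t)⟩
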